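/- \textbf{Theorem (Lower convergence rate bound).} Let $d>3$, $0<L\le U$, $\gamma\in\mathbb R$, $\alpha_\uparrow>1$, $0<\alpha_\downarrow<1$, and let $\|\cdot\|$ be the Euclidean norm on $\mathbb R^d$. \emph{Algorithm.} Let $z_0,z_1,\dots$ be independent $\mathcal N(0,I)$-distributed random vectors in $\mathbb R^d$. For a measurable $h:\mathbb R^d\to\mathbb R$ and $m_0\in\mathbb R^d$, $\sigma_0>0$, the (1+1)-ES on $h$ is given for $t\ge 0$ by $(m_{t+1},\sigma_{t+1})=(m_t+\sigma_tz_t,\ \alpha_\uparrow\sigma_t)$ if $h(m_t+\sigma_tz_t)\le h(m_t)$, and $(m_{t+1},\sigma_{t+1})=(m_t,\ \alpha_\downarrow\sigma_t)$ otherwise. \emph{Function class.} Let $\mathcal S_{d,L,U}$ be the set of continuously differentiable $f:\mathbb R^d\to\mathbb R$ with unique global minimum at the origin, $f(0)=0$, such that $$\tfrac L2\|x-y\|^2\le f(y)-f(x)-\langle y-x,\nabla f(x)\rangle\le\tfrac U2\|x-y\|^2\qquad\text{for all }x,y\in\mathbb R^d,$$ and such that, with $Q_z(m,\sigma)=\frac{2}{\sigma^2}\bigl(f(m+\sigma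 z)-f(m)-\langle\nabla f(m),\sigma z\rangle\bigr)$, $z\sim\mathcal N(0,I)$, $z_e=\langle z,\nabla f(m)\rangle/\|\nabla f(m)\|$, $\Phi$ the cumulative distribution function of $\mathcal N(0,1)$, and $$\kappa_{\inf}=\inf_{m\neq0,\ \sigma>0}\frac{\mathbb E[Q_z(m,\sigma)]}{\mathbb E[Q_z(m,\sigma)\mathbf 1\{z_e\le0\}]},$$ one has $$\sup_{m\ne0,\ \sigma>0}\frac{\operatorname{Var}[Q_z(m,\sigma)]}{(\mathbb E[Q_z(m,\sigma)])^2}<\frac14\min\Bigl\{\Phi\Bigl(\tfrac{\kappa_{\inf}}{2}\tfrac{1}{\sqrt{2\pi}}\Bigr)-\tfrac12,\ 1-\Phi\Bigl(\tfrac{\kappa_{\inf}}{2}\tfrac{3}{\sqrt{2\pi}}\Bigr)\Bigr\}.$$ Let $\mathcal P^\gamma_{d,L,U}$ be the set of functions $h:\mathbb R^d\to\mathbb R$ that have a unique global minimum point $x^{\mathrm{opt}}$ and for which there are $f\in\mathcal S_{d,L,U}$ and a strictly increasing $g:\mathbb R\to\mathbb R$ with $h(x)=g(f(x-x^{\mathrm{opt}}))$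 whenever $h(x)\le\gamma$. \emph{Claim.} Let $h\in\mathcal P^\gamma_{d,L,U}$ be measurable, with minimum point $x^{\mathrm{opt}}$, and let $m_0\neq x^{\mathrm{opt}}$, $\sigma_0>0$. Then, with the convention $\log 0=-\infty$, almost surely $$\liminf_{t\to\infty}\frac1t\log\left(\frac{\|m_t-x^{\mathrm{opt}}\|}{\|m_0-x^{\mathrm{opt}}\|}\right)\ge-\frac1d .$$ In particular, if $\exp(-\mathrm{CR}^{\mathrm{lower}})$ is the lower convergence rate of the (1+1)-ES on $h$, i.e. if $\mathrm{CR}^{\mathrm{lower}}\in\mathbb R$ is a constant such that the above $\liminf$ equals $-\mathrm{CR}^{\mathrm{lower}}$ almost surely, then $\exp(-\mathrm{CR}^{\mathrm{lower}})\ge\exp(-1/d)$. -/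

import Mathlib

open MeasureTheory ProbabilityTheory Filter

noncomputable section

namespace OnePlusOneES

/-- The search space `ℝ^d` with its Euclidean norm. -/
abbrev Space (d : ℕ) : Type := EuclideanSpace ℝ (Fin d)

/-- The state space: a state is `θ = (m, log σ)`. -/
abbrev State (d : ℕ) : Type := Space d × ℝ

/-! ### The algorithm -/

/-- The increment `𝒢(θ, z; f)` of the state `θ = (m, log σ)`; here `σ = exp θ.2`. -/
def increment {d : ℕ} (αup αdown : ℝ) (f : Space d → ℝ) (θ : State d) (z : Space d) : State d :=
  if f (θ.1 + Real.exp θ.2 • z) ≤ f θ.1 then (Real.exp θ.2 • z, Real.log αup)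
  else (0, Real.log αdown)

/-- The state sequence of the (1+1)-ES on `f`, started in `θ₀` and driven by the sampled vectors
`z 0, z 1, …`. -/
def chain {d : ℕ} (αup αdown : ℝ) (f : Space d → ℝ) (θ₀ : State d) (z : ℕ → Space d) :
    ℕ → State d
  | 0 => θ₀
  | t + 1 => chain αup αdown f θ₀ z t + increment αup αdown f (chain αup αdown f θ₀ z t) (z t)

/-! ### Convergence rate -/

/-- `liminf_{t → ∞} (1/t) log (‖m_t - x‖ / ‖m_0 - x‖)`, as an extended real number, with
`log 0 = -∞`. -/
def lowerSlope {d : ℕ} (m : ℕ → Space d) (x : Space d) : EReal :=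
  liminf (fun t : ℕ => ENNReal.log (ENNReal.ofReal (‖m t - x‖ / ‖m 0 - x‖)) / (t : EReal)) atTop

/-- `exp (-CR)` is the lower convergence rate of the random sequence `m` towards `x`: almost
surely `liminf_{t → ∞} (1/t) log (‖m_t - x‖ / ‖m_0 - x‖) = -CR`. -/
def IsLowerConvergenceRate {Ω : Type*} [MeasurableSpace Ω] (μ : Measure Ω) {d : ℕ}
    (m : ℕ → Ω → Space d) (x : Space d) (CR : ℝ) : Prop :=
  ∀ᵐ ω ∂μ, lowerSlope (fun t => m t ω) x = ((-CR : ℝ) : EReal)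

/-! ### The class of objective functions -/

/-- `x` is the unique global minimum point of `f`. -/
def IsUniqueGlobalMin {d : ℕ} (f : Space d → ℝ) (x : Space d) : Prop :=
  ∀ y, y ≠ x → f x < f y

/-- `L`-strong convexity over `S`, for a differentiable function. -/
def IsStronglyConvex {d : ℕ} (L : ℝ) (S : Set (Space d)) (f : Space d → ℝ) : Prop :=
  ∀ x ∈ S, ∀ y ∈ S, f x + inner ℝ (y - x) (gradient f x) + L / 2 * ‖x - y‖ ^ 2 ≤ f y

/-- `U`-Lipschitz smoothness over `S`, for a differentiable function. -/
def IsLipschitzSmooth {d : ℕ} (U : ℝ) (S : Set (Space d)) (f : Space d → ℝ) : Prop :=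
  ∀ x ∈ S, ∀ y ∈ S, f y ≤ f x + inner ℝ (y - x) (gradient f x) + U / 2 * ‖x - y‖ ^ 2

/-- `f` is continuously differentiable, `L`-strongly convex and `U`-Lipschitz smooth on `ℝ^d`, with
unique global minimum at the origin, of value `0`. -/
structure IsConvexSmooth {d : ℕ} (L U : ℝ) (f : Space d → ℝ) : Prop where
  contDiff : ContDiff ℝ 1 f
  stronglyConvex : IsStronglyConvex L Set.univ f
  lipschitzSmooth : IsLipschitzSmooth U Set.univ f
  uniqueMin : IsUniqueGlobalMin f 0
  map_zero : f 0 = 0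

/-- `𝒬_z(θ) = (2 / σ²) (f(m + σ z) - f(m) - ⟨∇f(m), σ z⟩)`, with `θ = (m, log σ)`. -/
def Q {d : ℕ} (f : Space d → ℝ) (θ : State d) (z : Space d) : ℝ :=
  2 / Real.exp θ.2 ^ 2 *
    (f (θ.1 + Real.exp θ.2 • z) - f θ.1 - inner ℝ (gradient f θ.1) (Real.exp θ.2 • z))

/-- `E[𝒬_z(θ)]` for a standard normal vector `z`. -/
def meanQ {d : ℕ} (f : Space d → ℝ) (θ : State d) : ℝ :=
  ∫ z, Q f θ z ∂(stdGaussian (Space d))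

/-- `E[𝒬_z(θ) · 1{z_e ≤ 0}]` for a standard normal vector `z`, where
`z_e = ⟨z, ∇f(m)⟩ / ‖∇f(m)‖`. -/
def meanQNeg {d : ℕ} (f : Space d → ℝ) (θ : State d) : ℝ :=
  ∫ z, Set.indicator {z : Space d | inner ℝ z (gradient f θ.1) / ‖gradient f θ.1‖ ≤ 0} (Q f θ) z
    ∂(stdGaussian (Space d))

/-- `Var[𝒬_z(θ)] / (E[𝒬_z(θ)])²` for a standard normal vector `z`. -/
def varStd {d : ℕ} (f : Space d → ℝ) (θ : State d) : ℝ :=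
  variance (Q f θ) (stdGaussian (Space d)) / meanQ f θ ^ 2

/-- `κ_inf`, the infimum over all states with `m ≠ 0` of `E[𝒬_z(θ)] / E[𝒬_z(θ) · 1{z_e ≤ 0}]`. -/
def kappaInf {d : ℕ} (f : Space d → ℝ) : ℝ :=
  ⨅ θ : {θ : State d // θ.1 ≠ 0}, meanQ f θ.1 / meanQNeg f θ.1

/-- The cumulative distribution function of the standard normal distribution on `ℝ`. -/
def Phi (x : ℝ) : ℝ := cdf (gaussianReal 0 1) x

/-- The bound on the normalized variance of `𝒬_z(θ)`, uniformly over the states with `m ≠ 0`. -/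
def VarianceCondition {d : ℕ} (f : Space d → ℝ) : Prop :=
  (⨆ θ : {θ : State d // θ.1 ≠ 0}, varStd f θ.1) <
    1 / 4 * min (Phi (kappaInf f / 2 * (1 / √(2 * Real.pi))) - 1 / 2)
      (1 - Phi (kappaInf f / 2 * (3 / √(2 * Real.pi))))

/-- The class `𝒮_{d,L,U}`. -/
def classS (d : ℕ) (L U : ℝ) : Set (Space d → ℝ) :=
  {f | IsConvexSmooth L U f ∧ VarianceCondition f}

/-- The class `𝒯^γ(f)`: functions `h` with a unique global minimum point `x` that agree with
`y ↦ g (f (y - x))`, for a strictly increasing `g`, on the sublevel set `{h ≤ γ}`. -/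
def classT {d : ℕ} (γ : ℝ) (f : Space d → ℝ) : Set (Space d → ℝ) :=
  {h | ∃ g : ℝ → ℝ, StrictMono g ∧ ∃ x : Space d, IsUniqueGlobalMin h x ∧
    ∀ y, h y ≤ γ → h y = g (f (y - x))}

/-- The class `𝒫^γ_{d,L,U}`. -/
def classP (d : ℕ) (L U γ : ℝ) : Set (Space d → ℝ) :=
  {h | ∃ f ∈ classS d L U, h ∈ classT γ f}

end OnePlusOneES

end

/-! A single step cannot shrink the distance to the optimum much, whatever the step size. Put `v = m
- xopt`, let `a` be the component of `z` along `v / ‖v‖` and `q = ‖z‖² - a²`. The whole line `v + ℝ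
z` keeps squared distance `‖v‖² q / ‖z‖²` from the origin, so the logarithmic distance drops by at
most `log (1 + a²/q) / 2 ≤ a² / (2q)`. It does not drop at all if `a ≥ 0` or if the step is rejected
(`log_norm_add_smul_ge`).

The direction of `v` depends on the past, but by rotation invariance the law of `(a, q)` does not
depend on that direction. Hence the pairs are identically distributed, and each is independent of
the past (`map_prodMk_stepProj`). The strong law shows that the averaged gain bounds converge almost
surely to their mean. Since `a` and `q` are independent and `q` is chi-squared with `d - 1` degrees
of freedom, this mean is `1/2 * E[a²; a < 0] * E[1/q] = 1 / (4 (d - 3))` (`integral_logGain`), which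
is at most `1/d` for `d ≥ 4`. -/

namespace OnePlusOneES

/-! ### One step of the algorithm -/

/-- The component of `z` along `e`, and the squared norm of the orthogonal component when `e` is
a unit vector. -/
noncomputable def lineProj {d : ℕ} (e z : Space d) : ℝ × ℝ :=
  (inner ℝ e z, ‖z‖ ^ 2 - inner ℝ e z ^ 2)

/-- An upper bound for the decrease of the logarithmic distance to the optimum along a line, in
terms of the components of the direction of the line. -/
noncomputable def logGain (p : ℝ × ℝ) : ℝ :=
  if p.1 < 0 then 1 / 2 * (p.1 ^ 2 / p.2) else 0

/-- The unit vector in the direction of `v`, with default value `e` for `v = 0`. -/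
noncomputable def direction {d : ℕ} (e v : Space d) : Space d :=
  if v = 0 then e else ‖v‖⁻¹ • v

/-- The default value `e` serves this lemma: the law of the projections must be the same for every
past, including one that has hit the optimum. -/
lemma norm_direction {d : ℕ} {e : Space d} (he : ‖e‖ = 1) (v : Space d) :
    ‖direction e v‖ = 1 := by
  unfold direction
  split_ifs with hv
  · exact he
  · rw [norm_smul, norm_inv, norm_norm, inv_mul_cancel₀ (norm_ne_zero_iff.mpr hv)]

lemma measurable_direction {d : ℕ} (e : Space d) : Measurable (direction e) := by
  unfold direction
  exact Measurable.ite (measurableSet_singleton 0) measurable_const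
    (measurable_norm.inv.smul measurable_id)

lemma continuous_lineProj {d : ℕ} :
    Continuous (fun p : Space d × Space d => lineProj p.1 p.2) := by
  unfold lineProj
  fun_prop

lemma measurable_lineProj {d : ℕ} (e : Space d) : Measurable (lineProj e) :=
  (continuous_lineProj.comp (Continuous.prodMk_right e)).measurable

lemma measurable_logGain : Measurable logGain := by
  unfold logGain
  exact Measurable.ite (measurableSet_lt measurable_fst measurable_const) (by fun_prop)
    measurable_const

lemma logGain_nonneg {p : ℝ × ℝ} (hp : 0 ≤ p.2) : 0 ≤ logGain p := by
  unfold logGain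
  split_ifs <;> positivity

/-- Distance from a point to a line: the bound is uniform in `s`, so the step-size adaptation plays
no role. -/
lemma log_norm_add_smul_ge {d : ℕ} {e v z : Space d} {s : ℝ} (hs : 0 < s) (hv : v ≠ 0)
    (hz : 0 < (lineProj (direction e v) z).2) :
    v + s • z ≠ 0 ∧
      Real.log ‖v‖ - logGain (lineProj (direction e v) z) ≤ Real.log ‖v + s • z‖ := by
  have hV : 0 < ‖v‖ := norm_pos_iff.mpr hv
  have hin : inner ℝ v z = ‖v‖ * inner ℝ (direction e v) z := by
    rw [direction, if_neg hv, real_inner_smul_left, mul_inv_cancel_left₀ hV.ne']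
  have hN : ‖v + s • z‖ ^ 2 =
      ‖v‖ ^ 2 + 2 * s * (‖v‖ * inner ℝ (direction e v) z) + s ^ 2 * ‖z‖ ^ 2 := by
    rw [norm_add_sq_real, real_inner_smul_right, hin, norm_smul, Real.norm_of_nonneg hs.le]
    ring
  simp only [lineProj] at hz ⊢
  generalize inner ℝ (direction e v) z = a at *
  simp only [logGain]
  have hNpos : 0 < ‖v + s • z‖ ^ 2 := by
    rw [hN]
    -- Splitting along `v` and orthogonally to it: `‖v + s z‖² = (‖v‖ + s a)² + s² q`.
    nlinarith [sq_nonneg (‖v‖ + s * a), mul_pos (pow_pos hs 2) hz]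
  have hne : v + s • z ≠ 0 := by
    rintro h0
    simp [h0] at hNpos
  refine ⟨hne, ?_⟩
  have hlogV : Real.log (‖v‖ ^ 2) = 2 * Real.log ‖v‖ := by rw [Real.log_pow]; norm_num
  have hlogN : Real.log (‖v + s • z‖ ^ 2) = 2 * Real.log ‖v + s • z‖ := by
    rw [Real.log_pow]; norm_num
  split_ifs with ha
  · set q := ‖z‖ ^ 2 - a ^ 2 with hq
    have hu : 0 ≤ a ^ 2 / q := by positivity
    have hle : ‖v‖ ^ 2 ≤ ‖v + s • z‖ ^ 2 * (1 + a ^ 2 / q) := by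
      have h1 : 1 + a ^ 2 / q = ‖z‖ ^ 2 / q := by
        field_simp
        rw [hq]; ring
      rw [h1, ← mul_div_assoc, le_div_iff₀ hz, hN, hq]
      -- The square is the exact difference of the two sides; it vanishes at the optimal step size
      -- `s = -‖v‖ a / ‖z‖²`.
      nlinarith [sq_nonneg (s * ‖z‖ ^ 2 + ‖v‖ * a)]
    have h2 := Real.log_le_log (by positivity) hle
    rw [Real.log_mul hNpos.ne' (by positivity), hlogV, hlogN] at h2
    have h3 := Real.log_le_sub_one_of_pos (show 0 < 1 + a ^ 2 / q by positivity)
    linarith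
  · have hle : ‖v‖ ^ 2 ≤ ‖v + s • z‖ ^ 2 := by
      rw [hN]
      have : 0 ≤ 2 * s * (‖v‖ * a) := by
        have := not_lt.mp ha
        positivity
      have : 0 ≤ s ^ 2 * ‖z‖ ^ 2 := by positivity
      linarith
    have h2 := Real.log_le_log (by positivity) hle
    rw [hlogV, hlogN] at h2
    linarith

lemma log_norm_chain_sub_ge {d : ℕ} {αup αdown : ℝ} {h : Space d → ℝ} {θ₀ : State d}
    {z : ℕ → Space d} {x e : Space d} (hθ₀ : θ₀.1 ≠ x)
    (hz : ∀ t, 0 < (lineProj (direction e ((chain αup αdown h θ₀ z t).1 - x)) (z t)).2) (t : ℕ) :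
    (chain αup αdown h θ₀ z t).1 ≠ x ∧
      Real.log ‖θ₀.1 - x‖ - ∑ s ∈ Finset.range t,
          logGain (lineProj (direction e ((chain αup αdown h θ₀ z s).1 - x)) (z s)) ≤
        Real.log ‖(chain αup αdown h θ₀ z t).1 - x‖ := by
  induction t with
  | zero => simpa [chain] using hθ₀
  | succ t ih =>
    obtain ⟨hne, hle⟩ := ih
    have hgain := logGain_nonneg (hz t).le
    obtain ⟨h1, h2⟩ := log_norm_add_smul_ge (Real.exp_pos (chain αup αdown h θ₀ z t).2)
      (sub_ne_zero.mpr hne) (hz t)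
    rw [Finset.sum_range_succ]
    simp only [chain, increment] at *
    split_ifs with hacc
    · simp only [Prod.fst_add]
      rw [add_sub_right_comm]
      refine ⟨fun h0 => h1 ?_, by linarith⟩
      rw [← add_sub_right_comm, h0, sub_self]
    · simp only [Prod.fst_add, add_zero]
      exact ⟨hne, by linarith⟩

/-- Only `z s` with `s < t` enter and the σ-algebra is arbitrary, so that taking `past z t` for it
gives adaptedness. -/
lemma measurable_chain {Ω : Type*} [MeasurableSpace Ω] {d : ℕ} {αup αdown : ℝ}
    {h : Space d → ℝ} (h_meas : Measurable h) (θ₀ : State d) (z : ℕ → Ω → Space d) (t : ℕ)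
    (hz : ∀ s < t, Measurable (z s)) :
    Measurable (fun ω => chain αup αdown h θ₀ (fun s => z s ω) t) := by
  induction t with
  | zero => exact measurable_const
  | succ t ih =>
    have hc := ih fun s hs => hz s (hs.trans t.lt_succ_self)
    have hzt := hz t t.lt_succ_self
    simp only [chain, increment]
    refine hc.add (Measurable.ite (measurableSet_le (h_meas.comp ?_) (h_meas.comp hc.fst)) ?_ ?_)
    · exact hc.fst.add (hc.snd.exp.smul hzt)
    · exact (hc.snd.exp.smul hzt).prodMk measurable_const
    · exact measurable_const

/-! ### Randomized functions of an independent variable -/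

/-- If `φ (x, Z)` has the same law for each value `x` of `X`, then conditioning on `(V, X)` reveals
nothing about `φ (X, Z)`. `V` and `X` may depend on each other. -/
lemma map_prodMk_comp_eq_prod {Ω α β ζ δ : Type*} [MeasurableSpace Ω] [MeasurableSpace α]
    [MeasurableSpace β] [MeasurableSpace ζ] [MeasurableSpace δ] {μ : Measure Ω}
    [IsProbabilityMeasure μ] {V : Ω → α} {X : Ω → β} {Z : Ω → ζ} {φ : β × ζ → δ}
    (hφ : Measurable φ) (hV : Measurable V) (hX : Measurable X) (hZ : Measurable Z)
    (hind : IndepFun (fun ω => (V ω, X ω)) Z μ) {ν : Measure δ} [IsProbabilityMeasure ν]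
    (hν : ∀ x ∈ Set.range X, (μ.map Z).map (fun z => φ (x, z)) = ν) :
    μ.map (fun ω => (V ω, φ (X ω, Z ω))) = (μ.map V).prod ν := by
  have : IsProbabilityMeasure (μ.map V) := Measure.isProbabilityMeasure_map hV.aemeasurable
  have : IsProbabilityMeasure (μ.map Z) := Measure.isProbabilityMeasure_map hZ.aemeasurable
  have hVX : Measurable (fun ω => (V ω, X ω)) := hV.prodMk hX
  have : IsProbabilityMeasure (μ.map fun ω => (V ω, X ω)) :=
    Measure.isProbabilityMeasure_map hVX.aemeasurable
  symm
  refine Measure.prod_eq fun s t hs ht => ?_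
  have hψ : Measurable (fun p : (α × β) × ζ => (p.1.1, φ (p.1.2, p.2))) :=
    measurable_fst.fst.prodMk (hφ.comp (measurable_fst.snd.prodMk measurable_snd))
  have hjoint := (indepFun_iff_map_prod_eq_prod_map_map hVX.aemeasurable hZ.aemeasurable).mp hind
  have hcomp : μ.map (fun ω => (V ω, φ (X ω, Z ω))) =
      (μ.map fun ω => ((V ω, X ω), Z ω)).map (fun p => (p.1.1, φ (p.1.2, p.2))) := by
    rw [Measure.map_map hψ (hVX.prodMk hZ)]
    rfl
  rw [hcomp, hjoint, Measure.map_apply hψ (hs.prod ht),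
    Measure.prod_apply (hψ (hs.prod ht)), lintegral_map (measurable_measure_prodMk_left
      (hψ (hs.prod ht))) hVX]
  -- For fixed `ω` the section is empty or has mass `ν t`, by `hν` at `X ω`.
  have hpt : ∀ ω, (μ.map Z) (Prod.mk (V ω, X ω) ⁻¹'
      ((fun p : (α × β) × ζ => (p.1.1, φ (p.1.2, p.2))) ⁻¹' s ×ˢ t)) =
      (V ⁻¹' s).indicator (fun _ => ν t) ω := by
    intro ω
    by_cases hω : V ω ∈ s
    · rw [Set.indicator_of_mem (by exact hω), ← hν (X ω) ⟨ω, rfl⟩,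
        Measure.map_apply (f := fun z => φ (X ω, z)) (hφ.comp measurable_prodMk_left) ht]
      congr 1
      ext z
      simp [hω]
    · rw [Set.indicator_of_notMem (by exact hω)]
      convert measure_empty (μ := μ.map Z)
      ext z
      simp [hω]
  simp_rw [hpt]
  rw [lintegral_indicator_const (hV hs), Measure.map_apply hV hs, mul_comm]

/-- The reflection in the hyperplane orthogonal to `e - e'` sends `e` to `e'` and preserves the
Gaussian. -/
lemma map_lineProj_stdGaussian {d : ℕ} {e e' : Space d} (h : ‖e‖ = ‖e'‖) :
    (stdGaussian (Space d)).map (lineProj e) = (stdGaussian (Space d)).map (lineProj e') := by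
  set R := (Submodule.span ℝ {e - e'})ᗮ.reflection
  have hR : R e = e' := Submodule.reflection_sub h
  conv_rhs => rw [← stdGaussian_map R]
  rw [Measure.map_map (measurable_lineProj e') R.continuous.measurable]
  congr 1
  ext z : 1
  simp [lineProj, ← hR]

/-! ### Gaussian integrals -/

lemma integrable_exp_neg_mul_sq_gaussianReal {s : ℝ} (hs : 0 ≤ s) :
    Integrable (fun x : ℝ => Real.exp (-(s * x ^ 2))) (gaussianReal 0 1) := by
  refine Integrable.of_bound (by fun_prop) 1 (ae_of_all _ fun x => ?_)
  rw [Real.norm_of_nonneg (Real.exp_pos _).le, Real.exp_le_one_iff]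
  have : 0 ≤ s * x ^ 2 := by positivity
  linarith

lemma integral_exp_neg_mul_sq_gaussianReal {s : ℝ} (hs : 0 ≤ s) :
    ∫ x, Real.exp (-(s * x ^ 2)) ∂(gaussianReal 0 1) = (√(1 + 2 * s))⁻¹ := by
  rw [integral_gaussianReal_eq_integral_smul one_ne_zero]
  have h : ∀ x : ℝ, gaussianPDFReal 0 1 x • Real.exp (-(s * x ^ 2)) =
      (√(2 * Real.pi))⁻¹ * Real.exp (-(1 / 2 + s) * x ^ 2) := by
    intro x
    simp only [gaussianPDFReal, NNReal.coe_one, mul_one, sub_zero, smul_eq_mul]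
    rw [mul_assoc, ← Real.exp_add]
    ring_nf
  simp_rw [h]
  rw [integral_const_mul, integral_gaussian, ← Real.sqrt_inv, ← Real.sqrt_inv,
    ← Real.sqrt_mul (by positivity)]
  congr 1
  have := Real.pi_pos.ne'
  field_simp

lemma integrable_indicator_sq_gaussianReal (s : Set ℝ) (hs : MeasurableSet s) :
    Integrable (s.indicator fun x : ℝ => x ^ 2) (gaussianReal 0 1) :=
  ((memLp_id_gaussianReal (μ := 0) (v := 1) 2).integrable_sq).indicator hs

/-- By symmetry, half of the variance. -/
lemma integral_indicator_Iio_sq_gaussianReal :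
    ∫ x, (Set.Iio 0).indicator (fun x : ℝ => x ^ 2) x ∂(gaussianReal 0 1) = 1 / 2 := by
  have hneg : ∫ x, (Set.Iio 0).indicator (fun x : ℝ => x ^ 2) x ∂(gaussianReal 0 1) =
      ∫ x, (Set.Ioi 0).indicator (fun x : ℝ => x ^ 2) x ∂(gaussianReal 0 1) := by
    have hmap : (gaussianReal 0 1).map (fun x : ℝ => -x) = gaussianReal 0 1 := by
      simpa using gaussianReal_map_neg (μ := 0) (v := 1)
    conv_lhs => rw [← hmap]
    rw [integral_map (by fun_prop)
      ((by fun_prop : Measurable fun x : ℝ => x ^ 2).indicator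
        measurableSet_Iio).aestronglyMeasurable]
    congr 1
    ext x
    simp [Set.indicator_apply]
  have hadd : ∫ x, (Set.Iio 0).indicator (fun x : ℝ => x ^ 2) x ∂(gaussianReal 0 1) +
      ∫ x, (Set.Ioi 0).indicator (fun x : ℝ => x ^ 2) x ∂(gaussianReal 0 1) = 1 := by
    rw [← integral_add (integrable_indicator_sq_gaussianReal _ measurableSet_Iio)
      (integrable_indicator_sq_gaussianReal _ measurableSet_Ioi)]
    have hvar := variance_fun_id_gaussianReal (μ := 0) (v := 1)
    rw [variance_of_integral_eq_zero (by fun_prop) (by simp)] at hvar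
    rw [← NNReal.coe_one, ← hvar]
    congr 1
    ext x
    rcases lt_trichotomy x 0 with h | h | h
    · simp [h, h.not_gt]
    · simp [h]
    · simp [h, h.not_gt]
  linarith

lemma hasDerivAt_one_add_two_mul_rpow {a s : ℝ} (ha : 1 < a) (hs : 0 ≤ s) :
    HasDerivAt (fun s : ℝ => -(1 / (2 * (a - 1))) * (1 + 2 * s) ^ (1 - a))
      ((1 + 2 * s) ^ (-a)) s := by
  have h1 : HasDerivAt (fun s : ℝ => 1 + 2 * s) 2 s := by
    simpa using ((hasDerivAt_id s).const_mul 2).const_add 1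
  have h2 := (h1.rpow_const (p := 1 - a) (Or.inl (by positivity))).const_mul
    (-(1 / (2 * (a - 1))))
  refine h2.congr_deriv ?_
  rw [show 1 - a - 1 = -a by ring]
  have : a - 1 ≠ 0 := by linarith
  field_simp
  ring

/-- Applied with `a = n / 2` and `n = d - 1`; the condition `1 < a` is where `d > 3` is needed. -/
lemma lintegral_one_add_two_mul_rpow {a : ℝ} (ha : 1 < a) :
    ∫⁻ s in Set.Ioi (0 : ℝ), ENNReal.ofReal ((1 + 2 * s) ^ (-a)) =
      ENNReal.ofReal (1 / (2 * (a - 1))) := by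
  have hpos : ∀ s ∈ Set.Ioi (0 : ℝ), 0 ≤ (1 + 2 * s) ^ (-a) := fun s hs =>
    Real.rpow_nonneg (by have := Set.mem_Ioi.mp hs; positivity) _
  have hlim : Tendsto (fun s : ℝ => -(1 / (2 * (a - 1))) * (1 + 2 * s) ^ (1 - a)) atTop
      (nhds 0) := by
    have h1 : Tendsto (fun s : ℝ => 1 + 2 * s) atTop atTop :=
      tendsto_atTop_add_const_left _ _ (tendsto_id.const_mul_atTop two_pos)
    have h2 := ((tendsto_rpow_neg_atTop (sub_pos.mpr ha)).comp h1).const_mul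
      (-(1 / (2 * (a - 1))))
    simpa [Function.comp_def] using h2
  rw [← ofReal_integral_eq_lintegral_ofReal
    (integrableOn_Ioi_deriv_of_nonneg'
      (fun s hs => hasDerivAt_one_add_two_mul_rpow ha hs) hpos hlim)
    ((ae_restrict_iff' measurableSet_Ioi).mpr (ae_of_all _ hpos)),
    integral_Ioi_of_hasDerivAt_of_nonneg'
      (fun s hs => hasDerivAt_one_add_two_mul_rpow ha hs) hpos hlim]
  simp

/-- Writes `1/q` as a mixture of exponentials, which factor over coordinates when `q` is a sum of
squares. -/
lemma lintegral_exp_neg_mul_Ioi {q : ℝ} (hq : 0 < q) :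
    ∫⁻ s in Set.Ioi (0 : ℝ), ENNReal.ofReal (Real.exp (-(s * q))) = ENNReal.ofReal q⁻¹ := by
  have h : ∀ s : ℝ, -(s * q) = -q * s := fun s => by ring
  simp_rw [h]
  rw [← ofReal_integral_eq_lintegral_ofReal (integrableOn_exp_mul_Ioi (by linarith) 0)
    (ae_of_all _ fun s => (Real.exp_pos _).le), integral_exp_mul_Ioi (by linarith)]
  simp

lemma lintegral_pi_gaussianReal_indicator_mul_exp (n : ℕ) {s : ℝ} (hs : 0 ≤ s) :
    ∫⁻ x, ENNReal.ofReal ((Set.Iio 0).indicator (fun x : ℝ => x ^ 2) (x 0) *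
        Real.exp (-(s * ∑ i : Fin n, x i.succ ^ 2)))
      ∂(Measure.pi fun _ : Fin (n + 1) => gaussianReal 0 1) =
      ENNReal.ofReal (1 / 2 * (1 + 2 * s) ^ (-(n / 2 : ℝ))) := by
  set F : Fin (n + 1) → ℝ → ℝ := Fin.cons ((Set.Iio 0).indicator fun x : ℝ => x ^ 2)
    (fun _ x => Real.exp (-(s * x ^ 2))) with hF
  have hprod : ∀ x : Fin (n + 1) → ℝ, (Set.Iio 0).indicator (fun x : ℝ => x ^ 2) (x 0) *
      Real.exp (-(s * ∑ i : Fin n, x i.succ ^ 2)) = ∏ i, F i (x i) := by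
    intro x
    rw [Fin.prod_univ_succ, Finset.mul_sum, ← Finset.sum_neg_distrib, Real.exp_sum]
    simp [hF]
  have hint : ∀ i, Integrable (F i) (gaussianReal 0 1) := by
    intro i
    refine Fin.cases ?_ (fun i => ?_) i
    · exact integrable_indicator_sq_gaussianReal _ measurableSet_Iio
    · exact integrable_exp_neg_mul_sq_gaussianReal hs
  have hnn : ∀ i x, 0 ≤ F i x := by
    intro i x
    refine Fin.cases ?_ (fun i => ?_) i
    · exact Set.indicator_nonneg (fun x _ => sq_nonneg x) x
    · exact (Real.exp_pos _).le
  simp_rw [hprod]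
  rw [← ofReal_integral_eq_lintegral_ofReal (Integrable.fintype_prod hint)
    (ae_of_all _ fun x => Finset.prod_nonneg fun i _ => hnn i (x i)),
    integral_fintype_prod_eq_prod, Fin.prod_univ_succ]
  congr 1
  simp only [hF, Fin.cons_zero, Fin.cons_succ, integral_indicator_Iio_sq_gaussianReal,
    integral_exp_neg_mul_sq_gaussianReal hs, Finset.prod_const, Finset.card_univ, Fintype.card_fin]
  congr 1
  have hu : 0 ≤ 1 + 2 * s := by positivity
  rw [Real.sqrt_eq_rpow, ← Real.rpow_neg hu, ← Real.rpow_natCast, ← Real.rpow_mul hu]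
  congr 1
  ring

lemma ae_sum_sq_succ_pos {n : ℕ} (hn : 0 < n) :
    ∀ᵐ x ∂(Measure.pi fun _ : Fin (n + 1) => gaussianReal 0 1),
      0 < ∑ i : Fin n, x i.succ ^ 2 := by
  let j : Fin (n + 1) := Fin.succ ⟨0, hn⟩
  have hj : ∀ᵐ x ∂(Measure.pi fun _ : Fin (n + 1) => gaussianReal 0 1), x j ≠ 0 := by
    have := nullSingletonClass_gaussianReal (μ := 0) (v := 1) one_ne_zero
    exact (measurePreserving_eval (fun _ : Fin (n + 1) => gaussianReal 0 1)
      j).quasiMeasurePreserving.ae (Measure.ae_ne _ 0)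
  filter_upwards [hj] with x hx
  exact Finset.sum_pos' (fun i _ => sq_nonneg _) ⟨⟨0, hn⟩, Finset.mem_univ _, by positivity⟩

/-- Tonelli with the exponential mixture for `1/q`. With `lintegral` no integrability is needed
beforehand; `integrable_logGain` follows from the finite value. -/
lemma lintegral_pi_gaussianReal_logGain {n : ℕ} (hn : 2 < n) :
    ∫⁻ x, ENNReal.ofReal (logGain (x 0, ∑ i : Fin n, x i.succ ^ 2))
      ∂(Measure.pi fun _ : Fin (n + 1) => gaussianReal 0 1) =
      ENNReal.ofReal (1 / (4 * (n - 2))) := by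
  have hn' : (2 : ℝ) < n := by exact_mod_cast hn
  have h1 : ∀ᵐ x ∂(Measure.pi fun _ : Fin (n + 1) => gaussianReal 0 1),
      ENNReal.ofReal (logGain (x 0, ∑ i : Fin n, x i.succ ^ 2)) =
      ENNReal.ofReal (1 / 2) * ∫⁻ s in Set.Ioi (0 : ℝ),
        ENNReal.ofReal ((Set.Iio 0).indicator (fun x : ℝ => x ^ 2) (x 0) *
        Real.exp (-(s * ∑ i : Fin n, x i.succ ^ 2))) := by
    filter_upwards [ae_sum_sq_succ_pos (by omega : 0 < n)] with x hx
    have hI : 0 ≤ (Set.Iio 0).indicator (fun x : ℝ => x ^ 2) (x 0) :=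
      Set.indicator_nonneg (fun x _ => sq_nonneg x) _
    simp_rw [ENNReal.ofReal_mul hI]
    rw [lintegral_const_mul _ (by fun_prop), lintegral_exp_neg_mul_Ioi hx,
      ← ENNReal.ofReal_mul hI, ← ENNReal.ofReal_mul (by norm_num)]
    congr 1
    simp only [logGain, Set.indicator_apply, Set.mem_Iio]
    split_ifs <;> simp [div_eq_mul_inv]
  have hmeas : Measurable (fun p : (Fin (n + 1) → ℝ) × ℝ =>
      ENNReal.ofReal ((Set.Iio 0).indicator (fun x : ℝ => x ^ 2) (p.1 0) *
        Real.exp (-(p.2 * ∑ i : Fin n, p.1 i.succ ^ 2)))) := by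
    have hI : Measurable ((Set.Iio 0).indicator fun x : ℝ => x ^ 2) :=
      (by fun_prop : Measurable fun x : ℝ => x ^ 2).indicator measurableSet_Iio
    have h2 : Measurable (fun p : (Fin (n + 1) → ℝ) × ℝ =>
        Real.exp (-(p.2 * ∑ i : Fin n, p.1 i.succ ^ 2))) := by fun_prop
    exact ((hI.comp ((measurable_pi_apply 0).comp measurable_fst)).mul h2).ennreal_ofReal
  rw [lintegral_congr_ae h1, lintegral_const_mul' _ _ ENNReal.ofReal_ne_top,
    lintegral_lintegral_swap hmeas.aemeasurable,
    setLIntegral_congr_fun measurableSet_Ioi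
      (fun s hs => lintegral_pi_gaussianReal_indicator_mul_exp n (Set.mem_Ioi.mp hs).le)]
  simp_rw [ENNReal.ofReal_mul (by norm_num : (0 : ℝ) ≤ 1 / 2)]
  rw [lintegral_const_mul' _ _ ENNReal.ofReal_ne_top,
    lintegral_one_add_two_mul_rpow (by linarith : (1 : ℝ) < n / 2),
    ← ENNReal.ofReal_mul (by norm_num), ← ENNReal.ofReal_mul (by norm_num)]
  congr 1
  have : (n : ℝ) - 2 ≠ 0 := by linarith
  have : (n : ℝ) / 2 - 1 ≠ 0 := by linarith
  field_simp
  ring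

/-! ### The law of the projections onto a line -/

/-- The law of the projections of a standard normal vector in `ℝ^(n + 1)` onto a line and its
orthogonal complement. -/
noncomputable def lineProjLaw (n : ℕ) : Measure (ℝ × ℝ) :=
  (Measure.pi fun _ : Fin (n + 1) => gaussianReal 0 1).map
    (fun x => (x 0, ∑ i : Fin n, x i.succ ^ 2))

instance (n : ℕ) : IsProbabilityMeasure (lineProjLaw n) :=
  Measure.isProbabilityMeasure_map (Measurable.aemeasurable (by fun_prop))

lemma map_lineProj_eq_lineProjLaw {n : ℕ} {e : Space (n + 1)} (he : ‖e‖ = 1) :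
    (stdGaussian (Space (n + 1))).map (lineProj e) = lineProjLaw n := by
  rw [map_lineProj_stdGaussian (e' := EuclideanSpace.single 0 1) (by simp [he]),
    ← map_pi_eq_stdGaussian, Measure.map_map (measurable_lineProj _) (by fun_prop), lineProjLaw]
  congr 1
  ext x : 1
  simp [lineProj, EuclideanSpace.inner_single_left, EuclideanSpace.real_norm_sq_eq,
    Fin.sum_univ_succ]

lemma ae_lineProjLaw_snd_pos {n : ℕ} (hn : 0 < n) : ∀ᵐ p ∂(lineProjLaw n), 0 < p.2 := by
  rw [lineProjLaw, ae_map_iff (Measurable.aemeasurable (by fun_prop))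
    (measurableSet_lt measurable_const measurable_snd)]
  exact ae_sum_sq_succ_pos hn

lemma lintegral_logGain_lineProjLaw {n : ℕ} (hn : 2 < n) :
    ∫⁻ p, ENNReal.ofReal (logGain p) ∂(lineProjLaw n) = ENNReal.ofReal (1 / (4 * (n - 2))) := by
  rw [lineProjLaw, lintegral_map measurable_logGain.ennreal_ofReal (by fun_prop)]
  exact lintegral_pi_gaussianReal_logGain hn

lemma ae_logGain_nonneg {n : ℕ} (hn : 0 < n) : 0 ≤ᵐ[lineProjLaw n] logGain := by
  filter_upwards [ae_lineProjLaw_snd_pos hn] with p hp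
  exact logGain_nonneg hp.le

lemma integrable_logGain {n : ℕ} (hn : 2 < n) : Integrable logGain (lineProjLaw n) := by
  refine ⟨measurable_logGain.aestronglyMeasurable, ?_⟩
  rw [hasFiniteIntegral_iff_ofReal (ae_logGain_nonneg (by omega)), lintegral_logGain_lineProjLaw hn]
  exact ENNReal.ofReal_lt_top

lemma integral_logGain {n : ℕ} (hn : 2 < n) :
    ∫ p, logGain p ∂(lineProjLaw n) = 1 / (4 * (n - 2)) := by
  have hn' : (2 : ℝ) < n := by exact_mod_cast hn
  rw [integral_eq_lintegral_of_nonneg_ae (ae_logGain_nonneg (by omega))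
    measurable_logGain.aestronglyMeasurable, lintegral_logGain_lineProjLaw hn,
    ENNReal.toReal_ofReal]
  have : 0 < (n : ℝ) - 2 := by linarith
  positivity

/-! ### The projections along the run of the algorithm -/

/-- The direction of the line through the optimum `x` and the current search point. -/
noncomputable def stepDir {d : ℕ} (αup αdown : ℝ) (h : Space d → ℝ) (θ₀ : State d) (x e : Space d)
    (z : ℕ → Space d) (t : ℕ) : Space d :=
  direction e ((chain αup αdown h θ₀ z t).1 - x)

/-- The projections of the sampled vector `z t` onto the line through the optimum `x` and the
current search point, and its orthogonal complement. -/
noncomputable def stepProj {d : ℕ} (αup αdown : ℝ) (h : Space d → ℝ) (θ₀ : State d) (x e : Space d)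
    (z : ℕ → Space d) (t : ℕ) : ℝ × ℝ :=
  lineProj (stepDir αup αdown h θ₀ x e z t) (z t)

lemma measurable_stepDir {Ω : Type*} [MeasurableSpace Ω] {d : ℕ} {αup αdown : ℝ}
    {h : Space d → ℝ} (h_meas : Measurable h) (θ₀ : State d) (x e : Space d)
    (z : ℕ → Ω → Space d) (t : ℕ) (hz : ∀ s < t, Measurable (z s)) :
    Measurable (fun ω => stepDir αup αdown h θ₀ x e (fun s => z s ω) t) := by
  have hc := (measurable_chain (αup := αup) (αdown := αdown) h_meas θ₀ z t hz).fst.sub_const x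
  exact (measurable_direction e).comp hc

lemma measurable_stepProj {Ω : Type*} [MeasurableSpace Ω] {d : ℕ} {αup αdown : ℝ}
    {h : Space d → ℝ} (h_meas : Measurable h) (θ₀ : State d) (x e : Space d)
    (z : ℕ → Ω → Space d) (t : ℕ) (hz : ∀ s ≤ t, Measurable (z s)) :
    Measurable (fun ω => stepProj αup αdown h θ₀ x e (fun s => z s ω) t) := by
  have hd := measurable_stepDir (αup := αup) (αdown := αdown) h_meas θ₀ x e z t
    fun s hs => hz s hs.le
  have hi := hd.inner (𝕜 := ℝ) (hz t le_rfl)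
  exact hi.prodMk (((hz t le_rfl).norm.pow_const 2).sub (hi.pow_const 2))

/-- The σ-algebra generated by `z 0, …, z (t - 1)`. -/
abbrev past {Ω : Type*} {d : ℕ} (z : ℕ → Ω → Space d) (t : ℕ) : MeasurableSpace Ω :=
  ⨆ s ∈ Set.Iio t, MeasurableSpace.comap (z s) inferInstance

lemma measurable_past {Ω : Type*} {d : ℕ} (z : ℕ → Ω → Space d) {s t : ℕ} (hst : s < t) :
    Measurable[past z t] (z s) := by
  rw [measurable_iff_comap_le]
  exact le_iSup₂_of_le s hst le_rfl

lemma past_le {Ω : Type*} [mΩ : MeasurableSpace Ω] {d : ℕ} {z : ℕ → Ω → Space d}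
    (hz_meas : ∀ t, Measurable (z t)) (t : ℕ) : past z t ≤ mΩ :=
  iSup₂_le fun s _ => (hz_meas s).comap_le

lemma indepFun_of_measurable_past {Ω : Type*} [MeasurableSpace Ω] {μ : Measure Ω} {d : ℕ}
    {z : ℕ → Ω → Space d} (hz_meas : ∀ t, Measurable (z t)) (hz_indep : iIndepFun z μ)
    {β : Type*} [MeasurableSpace β] {t : ℕ} {W : Ω → β} (hW : Measurable[past z t] W) :
    IndepFun W (z t) μ := by
  have hi := indep_iSup_of_disjoint (fun s => (hz_meas s).comap_le) hz_indep.iIndep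
    (S := Set.Iio t) (T := {t}) (by simp)
  rw [IndepFun_iff_Indep]
  refine indep_of_indep_of_le_right (indep_of_indep_of_le_left hi hW.comap_le) ?_
  simp

section

variable {Ω : Type*} [MeasurableSpace Ω] {μ : Measure Ω} [IsProbabilityMeasure μ] {n : ℕ}
  {αup αdown : ℝ} {z : ℕ → Ω → Space (n + 1)} {h : Space (n + 1) → ℝ}

/-- A constant `V` yields the law of each projection pair, an earlier pair as `V` yields pairwise
independence. -/
lemma map_prodMk_stepProj (hz_meas : ∀ t, Measurable (z t))
    (hz_law : ∀ t, μ.map (z t) = stdGaussian (Space (n + 1))) (hz_indep : iIndepFun z μ)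
    (h_meas : Measurable h) (θ₀ : State (n + 1)) (x : Space (n + 1)) {e : Space (n + 1)}
    (he : ‖e‖ = 1) {β : Type*} [MeasurableSpace β] {t : ℕ} {V : Ω → β}
    (hV : Measurable[past z t] V) :
    μ.map (fun ω => (V ω, stepProj αup αdown h θ₀ x e (fun s => z s ω) t)) =
      (μ.map V).prod (lineProjLaw n) := by
  have hdir : Measurable[past z t] (fun ω => stepDir αup αdown h θ₀ x e (fun s => z s ω) t) :=
    @measurable_stepDir Ω (past z t) _ αup αdown h h_meas θ₀ x e z t
      fun s hs => measurable_past z hs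
  refine map_prodMk_comp_eq_prod (φ := fun p => lineProj p.1 p.2) continuous_lineProj.measurable
    (hV.mono (past_le hz_meas t) le_rfl) (hdir.mono (past_le hz_meas t) le_rfl) (hz_meas t)
    (indepFun_of_measurable_past hz_meas hz_indep (hV.prodMk hdir)) ?_
  rintro _ ⟨ω, rfl⟩
  rw [hz_law]
  exact map_lineProj_eq_lineProjLaw (norm_direction he _)

lemma map_stepProj (hz_meas : ∀ t, Measurable (z t))
    (hz_law : ∀ t, μ.map (z t) = stdGaussian (Space (n + 1))) (hz_indep : iIndepFun z μ)
    (h_meas : Measurable h) (θ₀ : State (n + 1)) (x : Space (n + 1)) {e : Space (n + 1)}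
    (he : ‖e‖ = 1) (t : ℕ) :
    μ.map (fun ω => stepProj αup αdown h θ₀ x e (fun s => z s ω) t) = lineProjLaw n := by
  have h1 := map_prodMk_stepProj (αup := αup) (αdown := αdown) hz_meas hz_law hz_indep h_meas θ₀ x
    he (t := t) (V := fun _ => ()) measurable_const
  have h2 := congrArg (Measure.map Prod.snd) h1
  rw [Measure.map_map measurable_snd (measurable_const.prodMk
    (measurable_stepProj h_meas θ₀ x e z t fun s _ => hz_meas s)), Measure.map_snd_prod] at h2
  have : IsProbabilityMeasure (μ.map fun _ : Ω => ()) :=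
    Measure.isProbabilityMeasure_map measurable_const.aemeasurable
  rw [measure_univ, one_smul] at h2
  exact h2

lemma indepFun_stepProj_of_lt (hz_meas : ∀ t, Measurable (z t))
    (hz_law : ∀ t, μ.map (z t) = stdGaussian (Space (n + 1))) (hz_indep : iIndepFun z μ)
    (h_meas : Measurable h) (θ₀ : State (n + 1)) (x : Space (n + 1)) {e : Space (n + 1)}
    (he : ‖e‖ = 1) {r t : ℕ} (hrt : r < t) :
    IndepFun (fun ω => stepProj αup αdown h θ₀ x e (fun s => z s ω) r)
      (fun ω => stepProj αup αdown h θ₀ x e (fun s => z s ω) t) μ := by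
  have hm := fun t => measurable_stepProj (αup := αup) (αdown := αdown) h_meas θ₀ x e z t
    fun s _ => hz_meas s
  rw [indepFun_iff_map_prod_eq_prod_map_map (hm r).aemeasurable (hm t).aemeasurable,
    map_stepProj hz_meas hz_law hz_indep h_meas θ₀ x he t]
  exact map_prodMk_stepProj hz_meas hz_law hz_indep h_meas θ₀ x he
    (@measurable_stepProj Ω (past z t) _ αup αdown h h_meas θ₀ x e z r
      fun s hs => measurable_past z (hs.trans_lt hrt))

/-- The strong law of large numbers for the bounds on the logarithmic progress. -/
lemma ae_tendsto_average_logGain (hn : 2 < n) (hz_meas : ∀ t, Measurable (z t))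
    (hz_law : ∀ t, μ.map (z t) = stdGaussian (Space (n + 1))) (hz_indep : iIndepFun z μ)
    (h_meas : Measurable h) (θ₀ : State (n + 1)) (x : Space (n + 1)) {e : Space (n + 1)}
    (he : ‖e‖ = 1) :
    ∀ᵐ ω ∂μ, Tendsto (fun t : ℕ => (∑ s ∈ Finset.range t,
      logGain (stepProj αup αdown h θ₀ x e (fun s => z s ω) s)) / t) atTop
      (nhds (1 / (4 * (n - 2)))) := by
  have hm := fun t => measurable_stepProj (αup := αup) (αdown := αdown) h_meas θ₀ x e z t
    fun s _ => hz_meas s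
  have hlaw := map_stepProj (αup := αup) (αdown := αdown) hz_meas hz_law hz_indep h_meas θ₀ x he
  have hident : ∀ t, IdentDistrib (fun ω => stepProj αup αdown h θ₀ x e (fun s => z s ω) t)
      (fun ω => stepProj αup αdown h θ₀ x e (fun s => z s ω) 0) μ μ := fun t =>
    ⟨(hm t).aemeasurable, (hm 0).aemeasurable, by rw [hlaw, hlaw]⟩
  have hint : Integrable (fun ω => logGain (stepProj αup αdown h θ₀ x e (fun s => z s ω) 0)) μ := by
    have := integrable_logGain hn
    rw [← hlaw 0] at this
    exact this.comp_measurable (hm 0)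
  have hmean : ∫ ω, logGain (stepProj αup αdown h θ₀ x e (fun s => z s ω) 0) ∂μ =
      1 / (4 * (n - 2)) := by
    rw [← integral_logGain hn, ← hlaw 0,
      integral_map (hm 0).aemeasurable measurable_logGain.aestronglyMeasurable]
  rw [← hmean]
  -- Pairwise independence suffices for this form of the strong law.
  refine strong_law_ae_real
    (fun t ω => logGain (stepProj αup αdown h θ₀ x e (fun s => z s ω) t)) hint ?_
    fun t => (hident t).comp measurable_logGain
  intro r t hrt
  rcases lt_or_gt_of_ne hrt with hlt | hlt
  · exact (indepFun_stepProj_of_lt hz_meas hz_law hz_indep h_meas θ₀ x he hlt).comp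
      measurable_logGain measurable_logGain
  · exact ((indepFun_stepProj_of_lt hz_meas hz_law hz_indep h_meas θ₀ x he hlt).comp
      measurable_logGain measurable_logGain).symm

lemma ae_forall_stepProj_snd_pos (hn : 0 < n) (hz_meas : ∀ t, Measurable (z t))
    (hz_law : ∀ t, μ.map (z t) = stdGaussian (Space (n + 1))) (hz_indep : iIndepFun z μ)
    (h_meas : Measurable h) (θ₀ : State (n + 1)) (x : Space (n + 1)) {e : Space (n + 1)}
    (he : ‖e‖ = 1) :
    ∀ᵐ ω ∂μ, ∀ t, 0 < (stepProj αup αdown h θ₀ x e (fun s => z s ω) t).2 := by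
  rw [ae_all_iff]
  intro t
  have hpos := ae_lineProjLaw_snd_pos hn
  rw [← map_stepProj (αup := αup) (αdown := αdown) hz_meas hz_law hz_indep h_meas θ₀ x he t]
    at hpos
  exact ae_of_ae_map
    (measurable_stepProj h_meas θ₀ x e z t fun s _ => hz_meas s).aemeasurable hpos

end

/-- A lower bound on the slope from a lower bound on the logarithmic distances by partial sums
with convergent averages. -/
lemma neg_le_lowerSlope {d : ℕ} {m : ℕ → Space d} {x : Space d} {S : ℕ → ℝ} {c : ℝ}
    (hm : ∀ t, m t ≠ x) (hle : ∀ t, Real.log ‖m 0 - x‖ - S t ≤ Real.log ‖m t - x‖)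
    (hS : Tendsto (fun t : ℕ => S t / t) atTop (nhds c)) :
    ((-c : ℝ) : EReal) ≤ lowerSlope m x := by
  have hlim : Tendsto (fun t : ℕ => ((-(S t / t) : ℝ) : EReal)) atTop (nhds ((-c : ℝ) : EReal)) :=
    (continuous_coe_real_ereal.tendsto _).comp hS.neg
  rw [← hlim.liminf_eq, lowerSlope]
  -- `t = 0` is no exception, since division by zero gives zero in both `ℝ` and `EReal`.
  refine liminf_le_liminf (Eventually.of_forall fun t => ?_)
  have hpos : ∀ t, 0 < ‖m t - x‖ := fun t => norm_pos_iff.mpr (sub_ne_zero.mpr (hm t))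
  rw [ENNReal.log_ofReal_of_pos (div_pos (hpos t) (hpos 0)),
    Real.log_div (hpos t).ne' (hpos 0).ne', ← EReal.coe_coe_eq_natCast, ← EReal.coe_div,
    EReal.coe_le_coe_iff, ← neg_div]
  have := hle t
  gcongr
  linarith

end OnePlusOneES

theorem mainTheorem2 {Ω : Type*} [MeasurableSpace Ω] (μ : Measure Ω) [IsProbabilityMeasure μ]
    (d : ℕ) (hd : 3 < d) (L U γ : ℝ) (hL : 0 < L) (hLU : L ≤ U)
    (αup αdown : ℝ) (hup : 1 < αup) (hdown_pos : 0 < αdown) (hdown : αdown < 1)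
    (z : ℕ → Ω → OnePlusOneES.Space d) (hz_meas : ∀ t, Measurable (z t))
    (hz_law : ∀ t, μ.map (z t) = stdGaussian (OnePlusOneES.Space d))
    (hz_indep : iIndepFun z μ)
    (h : OnePlusOneES.Space d → ℝ) (h_meas : Measurable h)
    (hP : h ∈ OnePlusOneES.classP d L U γ)
    (xopt : OnePlusOneES.Space d) (hxopt : OnePlusOneES.IsUniqueGlobalMin h xopt)
    (θ₀ : OnePlusOneES.State d) (hθ₀ : θ₀.1 ≠ xopt) :
    (∀ᵐ ω ∂μ, ((-(1 / (d : ℝ)) : ℝ) : EReal) ≤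
      OnePlusOneES.lowerSlope
        (fun t => (OnePlusOneES.chain αup αdown h θ₀ (fun s => z s ω) t).1) xopt) ∧
    (∀ CR : ℝ,
      OnePlusOneES.IsLowerConvergenceRate μ
        (fun t ω => (OnePlusOneES.chain αup αdown h θ₀ (fun s => z s ω) t).1) xopt CR →
      Real.exp (-(1 / (d : ℝ))) ≤ Real.exp (-CR)) := by
  have hrate : ∀ᵐ ω ∂μ, ((-(1 / (d : ℝ)) : ℝ) : EReal) ≤
      OnePlusOneES.lowerSlope
        (fun t => (OnePlusOneES.chain αup αdown h θ₀ (fun s => z s ω) t).1) xopt := by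
    obtain ⟨n, rfl⟩ : ∃ n, d = n + 1 := ⟨d - 1, by omega⟩
    have hn : 2 < n := by omega
    have hn' : (3 : ℝ) ≤ n := by exact_mod_cast hn
    have he : ‖(EuclideanSpace.single 0 1 : OnePlusOneES.Space (n + 1))‖ = 1 := by simp
    filter_upwards [OnePlusOneES.ae_tendsto_average_logGain (αup := αup) (αdown := αdown) hn hz_meas
      hz_law hz_indep h_meas θ₀ xopt he, OnePlusOneES.ae_forall_stepProj_snd_pos (αup := αup)
      (αdown := αdown) (by omega) hz_meas hz_law hz_indep h_meas θ₀ xopt he] with ω hω hpos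
    have hchain := OnePlusOneES.log_norm_chain_sub_ge hθ₀ hpos
    refine le_trans ?_ (OnePlusOneES.neg_le_lowerSlope (fun t => (hchain t).1)
      (fun t => (hchain t).2) hω)
    -- What remains is `n + 1 ≤ 4 (n - 2)`, that is `3 ≤ n`, with equality at `d = 4`.
    rw [EReal.coe_le_coe_iff, neg_le_neg_iff]
    push_cast
    gcongr
    linarith
  refine ⟨hrate, fun CR hCR => ?_⟩
  obtain ⟨ω, hω, hω'⟩ := (hrate.and hCR).exists
  rw [hω', EReal.coe_le_coe_iff] at hω
  exact Real.exp_le_exp.mpr hω
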